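/- Consider $K$ actions $\mathcal K=\{1,\dots,K\}$ and a random probability distribution $p^*$ on $[0,1]^K$ (drawn from an arbitrary prior). Conditionally on $p^*$, the reward vectors $Y_t=(Y_{t,a})_{a\in\mathcal K}$, $t\ge 1$, are independent and identically distributed with law $p^*$; the coordinates of a reward vector may be dependent. Let $A^*$ be a random action that almost surely maximizes the true mean reward $a\mapsto\int y_a\,dp^*(y)$, and let $G_t=(\mathcal K,\mathcal E_t)$, $t\ge1$, be an arbitrary deterministic sequence of directed graphs. In round $t$ the decision maker plays an action $A_t$ and then observes $Y_{t,A_t}$ and $Y_{t,a}$ for every $a$ with $(A_t,a)\in\mathcal E_t$. Let $\mathcal F_t$ be the $\sigma$-algebra generated by the actions and observations of rounds $1,\dots,t-1$, and let $\alpha_t(a)=\mathbb P(A^*=a\mid\mathcal F_t)$ be the posterior distribution of $A^*$; in particular $\alpha_1$ is its prior distribution. The policy TS-N (Thompson sampling) draws $A_t$ from $\alpha_t$, with randomness that, given $\mathcal F_t$, is independent of $p^*$, $A^*$ and all the rewards $(Y_s)_{s\ge1}$. Then for every horizon $T$ the Bayesian regret of TS-N satisfies $$\mathbb E\Big[\sum_{t=1}^T\big(Y_{t,A^*}-Y_{t,A_t}\big)\Big]\;\le\;\sqrt{\frac12\sum_{t=1}^T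 \mathrm{mas}(G_t)\,H(\alpha_1)} .$$ Here $H(\alpha)=-\sum_{a}\alpha(a)\log\alpha(a)$ is the Shannon entropy (natural logarithm, $0\log 0=0$), and $\mathrm{mas}(G)$, the maximum acyclic subgraph number of $G$, is the largest cardinality of a set $\mathcal K'\subseteq\mathcal K$ such that the subgraph of $G$ induced by $\mathcal K'$ contains no directed cycle through two or more distinct vertices (self-loops are not counted as cycles). -/

import Mathlib

open MeasureTheory ProbabilityTheory unitInterval

namespace GraphBandit

/-- `S` induces an acyclic subgraph of `G`: no directed cycle `v 0 → v 1 → ⋯ → v (n+1) → v 0`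
through `n + 2 ≥ 2` distinct vertices has all its vertices in `S` (the index `i + 1` is taken
modulo `n + 2`). Self-loops are not counted as cycles; two opposite arcs are one. -/
def IsAcyclicOn {V : Type*} (G : Digraph V) (S : Finset V) : Prop :=
  ¬ ∃ (n : ℕ) (v : Fin (n + 2) → V),
    Function.Injective v ∧ (∀ i, v i ∈ S) ∧ ∀ i, G.Adj (v i) (v (i + 1))

open Classical in
/-- The maximum acyclic subgraph number: the largest size of a vertex set that induces an
acyclic subgraph. -/
noncomputable def mas {V : Type*} [Fintype V] (G : Digraph V) : ℕ :=
  (Finset.univ.filter fun S : Finset V => IsAcyclicOn G S).sup Finset.card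

/-- Shannon entropy (natural logarithm, with `0 log 0 = 0`) of a distribution on a finite set. -/
noncomputable def shannonEntropy {V : Type*} [Fintype V] (p : V → ℝ) : ℝ :=
  - ∑ i, p i * Real.log (p i)

/-- The mean reward of action `a` under the distribution `p` of the reward vector. -/
noncomputable def meanReward {K : ℕ} (p : Measure (Fin K → I)) (a : Fin K) : ℝ :=
  ∫ y, (y a : ℝ) ∂p

/-- A Bayesian stochastic bandit with `K` actions and rewards in `[0, 1]`, defined on the
probability space `(Ω, μ)`. Rounds are indexed from `0`. -/
structure BayesianBandit (K : ℕ) {Ω : Type*} [mΩ : MeasurableSpace Ω] (μ : Measure Ω) where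
  /-- the random true distribution of the reward vector; its law is the prior -/
  pStar : Ω → Measure (Fin K → I)
  measurable_pStar : Measurable pStar
  isProbabilityMeasure_pStar : ∀ ω, IsProbabilityMeasure (pStar ω)
  /-- the reward vectors: `Y t ω a` is the reward of action `a` in round `t` -/
  Y : ℕ → Ω → Fin K → I
  measurable_Y : ∀ t, Measurable (Y t)
  /-- conditionally on `pStar`, the reward vectors are independent with distribution `pStar` -/
  condLaw_Y : ∀ (s : Finset ℕ) (B : ℕ → Set (Fin K → I)), (∀ t, MeasurableSet (B t)) →
    μ⟦⋂ t ∈ s, Y t ⁻¹' B t | MeasurableSpace.comap pStar inferInstance⟧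
      =ᵐ[μ] fun ω => ∏ t ∈ s, (pStar ω).real (B t)
  /-- the optimal action: almost surely a maximiser of the true mean reward -/
  AStar : Ω → Fin K
  measurable_AStar : Measurable AStar
  optimal_AStar : ∀ᵐ ω ∂μ, ∀ a, meanReward (pStar ω) a ≤ meanReward (pStar ω) (AStar ω)

namespace BayesianBandit

variable {K : ℕ} {Ω : Type*} [mΩ : MeasurableSpace Ω] {μ : Measure Ω}

/-- The σ-algebra of everything that the decision maker does not influence: the true
distribution, the optimal action, and the rewards of all actions in all rounds. -/
@[reducible] def environment (M : BayesianBandit K μ) : MeasurableSpace Ω :=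
  MeasurableSpace.comap M.pStar inferInstance ⊔ MeasurableSpace.comap M.AStar inferInstance ⊔
    ⨆ t, MeasurableSpace.comap (M.Y t) inferInstance

open Classical in
/-- What the decision maker learns in round `t`: the action played, its reward, and the rewards
of its out-neighbours in `G t`. The coordinates that are not observed are replaced by `0`
(which ones these are is determined by the action played, as `G t` is deterministic). -/
noncomputable def observation (M : BayesianBandit K μ) (G : ℕ → Digraph (Fin K))
    (A : ℕ → Ω → Fin K) (t : ℕ) (ω : Ω) : Fin K × (Fin K → I) :=
  (A t ω, fun a => if a = A t ω ∨ (G t).Adj (A t ω) a then M.Y t ω a else 0)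

/-- The σ-algebra generated by the observations of the rounds before round `t`. -/
@[reducible] noncomputable def history (M : BayesianBandit K μ) (G : ℕ → Digraph (Fin K)) (A : ℕ → Ω → Fin K) (t : ℕ) :
    MeasurableSpace Ω :=
  ⨆ s ∈ Finset.range t, MeasurableSpace.comap (M.observation G A s) inferInstance

/-- The prior distribution of the optimal action. -/
noncomputable def prior (M : BayesianBandit K μ) (a : Fin K) : ℝ :=
  μ.real (M.AStar ⁻¹' {a})

/-- The posterior distribution of the optimal action given the history before round `t`. -/
noncomputable def posterior (M : BayesianBandit K μ) (G : ℕ → Digraph (Fin K))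
    (A : ℕ → Ω → Fin K) (t : ℕ) (a : Fin K) : Ω → ℝ :=
  μ⟦M.AStar ⁻¹' {a} | M.history G A t⟧

/-- The actions `A` are chosen by the randomized policy with sampling distributions `π`:
in every round `t`, `π t` is a function of the history, and the action is drawn from `π t` by
means of randomness that is independent of the environment given the history. -/
structure FollowsPolicy (M : BayesianBandit K μ) (G : ℕ → Digraph (Fin K))
    (A : ℕ → Ω → Fin K) (π : ℕ → Fin K → Ω → ℝ) : Prop where
  measurable_action : ∀ t, Measurable (A t)
  adapted : ∀ t a, Measurable[M.history G A t] (π t a)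
  sampling : ∀ t a, μ⟦A t ⁻¹' {a} | M.history G A t ⊔ M.environment⟧ =ᵐ[μ] π t a

/-- TS-N (Thompson sampling): the sampling distribution is the posterior distribution of the
optimal action. -/
def IsTSN (M : BayesianBandit K μ) (G : ℕ → Digraph (Fin K)) (A : ℕ → Ω → Fin K) : Prop :=
  M.FollowsPolicy G A (M.posterior G A)

/-- The Bayesian regret over the first `T` rounds of playing the actions `A`. -/
noncomputable def bayesRegret (M : BayesianBandit K μ) (A : ℕ → Ω → Fin K) (T : ℕ) : ℝ :=
  ∫ ω, ∑ t ∈ Finset.range T, ((M.Y t ω (M.AStar ω) : ℝ) - (M.Y t ω (A t ω) : ℝ)) ∂μ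

end BayesianBandit

end GraphBandit

/-!
The regret of one round is the sum over the actions `a` of the conditional covariances, given the
past, of the event `A* = a` with the reward of `a`, because the played action is drawn from the
posterior `α` independently of the rewards. Fenchel's inequality for `p log p` bounds the
expectation of `1_{A* = a}` times a variable of the new information by the loss of posterior entropy
in the coordinate `a`, provided that the exponential of the variable has conditional mean at most
`1`. Let `q a` be the posterior probability that the reward of `a` gets observed. Hoeffding's lemma
at the slope `c / q a`, applied when the reward is observed, shows that `c` times the `a`-th
covariance is at most the entropy loss plus `c² / 8 * α a / q a`. A greedy choice of vertices gives
`∑ a, α a / q a ≤ mas G`. The entropy losses telescope over the rounds, and the best `c` gives the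
square root.
-/

namespace GraphBandit

section AcyclicSets

variable {V : Type*} {G : Digraph V}

lemma isAcyclicOn_empty (G : Digraph V) : IsAcyclicOn G ∅ := by
  rintro ⟨n, v, -, hS, -⟩
  exact Finset.notMem_empty _ (hS 0)

lemma IsAcyclicOn.insert [DecidableEq V] {S : Finset V} (hS : IsAcyclicOn G S) {i : V}
    (hi : ∀ k ∈ S, ¬ G.Adj k i) : IsAcyclicOn G (insert i S) := by
  rintro ⟨n, v, hv, hmem, hadj⟩
  by_cases hvi : ∃ j, v j = i
  · obtain ⟨j, rfl⟩ := hvi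
    have hne : v (j - 1) ≠ v j := hv.ne (by simp)
    have hpred : G.Adj (v (j - 1)) (v j) := by simpa using hadj (j - 1)
    exact hi _ (Finset.mem_of_mem_insert_of_ne (hmem _) hne) hpred
  · push Not at hvi
    exact hS ⟨n, v, hv, fun j => Finset.mem_of_mem_insert_of_ne (hmem j) (hvi j), hadj⟩

lemma IsAcyclicOn.card_le_mas [Fintype V] {S : Finset V} (hS : IsAcyclicOn G S) :
    S.card ≤ mas G := by
  classical
  exact Finset.le_sup (f := Finset.card) (by simpa using hS)

open Classical in
/-- The closed in-neighbourhood of `a`, that is, the set of the actions that reveal the reward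
of `a`. -/
noncomputable def revealers [Fintype V] (G : Digraph V) (a : V) : Finset V :=
  {k | a = k ∨ G.Adj k a}

lemma mem_revealers [Fintype V] {a k : V} : k ∈ revealers G a ↔ a = k ∨ G.Adj k a := by
  simp [revealers]

lemma self_mem_revealers [Fintype V] (G : Digraph V) (a : V) : a ∈ revealers G a :=
  mem_revealers.2 (.inl rfl)

lemma div_le_div_left_of_le_of_le {p q r : ℝ} (hp : 0 ≤ p) (hpr : p ≤ r) (hrq : r ≤ q) :
    p / q ≤ p / r := by
  rcases hp.eq_or_lt with rfl | hp
  · simp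
  · exact div_le_div_of_nonneg_left hp.le (hp.trans_le hpr) hrq

variable [Fintype V] [DecidableEq V] {p : V → ℝ}

/-- Greedy choice: `i` minimises the weight of its closed in-neighbourhood within `U`. -/
lemma exists_sum_inter_revealers_div_le_one (G : Digraph V) (hp : ∀ a, 0 ≤ p a) {U : Finset V}
    (hU : U.Nonempty) :
    ∃ i ∈ U, ∑ a ∈ U ∩ revealers G i, p a / ∑ k ∈ U ∩ revealers G a, p k ≤ 1 := by
  obtain ⟨i, hiU, hi⟩ := U.exists_min_image (fun a => ∑ k ∈ U ∩ revealers G a, p k) hU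
  refine ⟨i, hiU, ?_⟩
  calc ∑ a ∈ U ∩ revealers G i, p a / ∑ k ∈ U ∩ revealers G a, p k
      ≤ ∑ a ∈ U ∩ revealers G i, p a / ∑ k ∈ U ∩ revealers G i, p k :=
        Finset.sum_le_sum fun a ha => div_le_div_left_of_le_of_le (hp a)
          (Finset.single_le_sum (fun k _ => hp k) ha) (hi a (Finset.mem_inter.1 ha).1)
    _ ≤ 1 := by
        rw [← Finset.sum_div]
        exact div_self_le_one _

lemma exists_isAcyclicOn_sum_div_le (G : Digraph V) (hp : ∀ a, 0 ≤ p a) (U : Finset V) :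
    ∃ S ⊆ U, IsAcyclicOn G S ∧ ∑ a ∈ U, p a / ∑ k ∈ U ∩ revealers G a, p k ≤ S.card := by
  induction U using Finset.strongInduction with
  | H U ih =>
  rcases U.eq_empty_or_nonempty with rfl | hU
  · exact ⟨∅, le_rfl, isAcyclicOn_empty G, by simp⟩
  obtain ⟨i, hiU, hi⟩ := exists_sum_inter_revealers_div_le_one G hp hU
  obtain ⟨S, hSU, hS, hle⟩ := ih (U \ revealers G i) <|
    Finset.sdiff_subset.ssubset_of_mem_notMem hiU fun h =>
      (Finset.mem_sdiff.1 h).2 (self_mem_revealers G i)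
  have hSi : ∀ k ∈ S, k ∉ revealers G i := fun k hk => (Finset.mem_sdiff.1 (hSU hk)).2
  refine ⟨insert i S, Finset.insert_subset hiU (hSU.trans Finset.sdiff_subset),
    hS.insert fun k hk h => hSi k hk (mem_revealers.2 (.inr h)), ?_⟩
  have hrest : ∑ a ∈ U \ revealers G i, p a / ∑ k ∈ U ∩ revealers G a, p k ≤ S.card := by
    refine le_trans (Finset.sum_le_sum fun a ha => ?_) hle
    refine div_le_div_left_of_le_of_le (hp a) (Finset.single_le_sum (fun k _ => hp k)
      (Finset.mem_inter.2 ⟨ha, self_mem_revealers G a⟩)) ?_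
    exact Finset.sum_le_sum_of_subset_of_nonneg
      (Finset.inter_subset_inter_right Finset.sdiff_subset) fun k _ _ => hp k
  rw [Finset.card_insert_of_notMem fun h => hSi i h (self_mem_revealers G i),
    ← Finset.sum_inter_add_sum_sdiff U (revealers G i)]
  push_cast
  linarith

omit [DecidableEq V] in
lemma sum_div_sum_revealers_le_mas (G : Digraph V) (hp : ∀ a, 0 ≤ p a) :
    ∑ a, p a / ∑ k ∈ revealers G a, p k ≤ mas G := by
  classical
  obtain ⟨S, -, hS, hle⟩ := exists_isAcyclicOn_sum_div_le G hp Finset.univ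
  simp only [Finset.univ_inter] at hle
  exact hle.trans (by exact_mod_cast hS.card_le_mas)

end AcyclicSets

section RealInequalities

lemma exp_add_mul_sub_le {t : ℝ} (ht : t ∈ I) (a b : ℝ) :
    Real.exp (a + t * (b - a)) ≤ Real.exp a + t * (Real.exp b - Real.exp a) := by
  have h := convexOn_exp.2 (Set.mem_univ a) (Set.mem_univ b) (sub_nonneg.2 ht.2) ht.1
    (sub_add_cancel 1 t)
  simp only [smul_eq_mul] at h
  calc Real.exp (a + t * (b - a)) = Real.exp ((1 - t) * a + t * b) := by ring_nf
    _ ≤ _ := by linarith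

lemma hoeffding_bernoulli (l : ℝ) {m : ℝ} (hm : m ∈ I) :
    (1 - m) * Real.exp (-l * m) + m * Real.exp (l * (1 - m)) ≤ Real.exp (l ^ 2 / 8) := by
  have hmgf := (hasSubgaussianMGF_of_mem_Icc (μ := bernoulliMeasure (1 : ℝ) 0 ⟨m, hm⟩) (X := id)
    (a := 0) (b := 1) aemeasurable_id ?_).mgf_le l
  · simp only [mgf, integral_bernoulliMeasure, id, smul_eq_mul, mul_one, mul_zero, add_zero,
      zero_sub, sub_zero, nnnorm_one] at hmgf
    convert hmgf using 1
    · rw [mul_neg, neg_mul, add_comm]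
    · congr 1
      norm_num
      ring
  · rw [bernoulliMeasure_def, ae_add_measure_iff]
    constructor <;>
    · refine Measure.ae_smul_measure ?_ _
      rw [ae_dirac_eq]
      simp

lemma negMulLog_add_mul_one_add_le_exp {p : ℝ} (hp : 0 ≤ p) (x : ℝ) :
    Real.negMulLog p + p * (1 + x) ≤ Real.exp x := by
  rcases hp.eq_or_lt with rfl | hp
  · simpa using Real.exp_nonneg x
  · have h := Real.add_one_le_exp (x - Real.log p)
    rw [Real.exp_sub, Real.exp_log hp, le_div_iff₀ hp] at h
    rw [Real.negMulLog]
    linarith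

lemma self_add_le_mul_one_add_log_add {p δ : ℝ} (hp : 0 ≤ p) (hδ : 0 ≤ δ) :
    p + δ ≤ p * (1 + Real.log (p + δ)) + (Real.negMulLog p + δ) := by
  rcases hp.eq_or_lt with rfl | hp
  · simp
  · have := mul_le_mul_of_nonneg_left (Real.log_le_log hp (le_add_of_nonneg_right hδ)) hp.le
    rw [Real.negMulLog]
    linarith

lemma mul_mul_inv_add_sq_le_div {p q ε : ℝ} (hp : 0 ≤ p) (hpq : p ≤ q) (hε : 0 < ε) :
    p * (q * (q + ε)⁻¹ ^ 2) ≤ p / q := by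
  rw [div_eq_mul_inv]
  refine mul_le_mul_of_nonneg_left ?_ hp
  rcases (hp.trans hpq).eq_or_lt with rfl | hq
  · simp
  · rw [inv_pow, ← div_eq_mul_inv, div_le_iff₀ (by positivity), ← div_eq_inv_mul, le_div_iff₀ hq]
    nlinarith

lemma mul_one_sub_mul_inv_add_le {p q ε : ℝ} (hp : 0 ≤ p) (hpq : p ≤ q) (hε : 0 < ε) :
    p * (1 - q * (q + ε)⁻¹) ≤ ε := by
  have hqε : 0 < q + ε := by linarith
  have : p * (1 - q * (q + ε)⁻¹) = p * ε / (q + ε) := by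
    field_simp
    ring
  rw [this, div_le_iff₀ hqε]
  nlinarith

lemma mul_cutoff_le {p q ε c : ℝ} (hp : 0 ≤ p) (hpq : p ≤ q) (hε : 0 < ε) (hc : 0 ≤ c) :
    p * (q * (c * (q + ε)⁻¹) ^ 2 / 8 + c * (1 - q * (q + ε)⁻¹)) ≤ c ^ 2 / 8 * (p / q) + c * ε := by
  have hsq := mul_le_mul_of_nonneg_left (mul_mul_inv_add_sq_le_div hp hpq hε)
    (by positivity : 0 ≤ c ^ 2 / 8)
  have hlin := mul_le_mul_of_nonneg_left (mul_one_sub_mul_inv_add_le hp hpq hε) hc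
  linarith

lemma le_sqrt_of_forall_mul_le {R H S : ℝ} (hH : 0 ≤ H) (hS : 0 ≤ S)
    (h : ∀ c > 0, c * R ≤ H + c ^ 2 / 8 * S) : R ≤ √(1 / 2 * (S * H)) := by
  rcases le_or_gt R 0 with hR | hR
  · exact hR.trans (Real.sqrt_nonneg _)
  refine Real.le_sqrt_of_sq_le ?_
  have hquad : ∀ c : ℝ, 0 ≤ S / 8 * (c * c) + -R * c + H := fun c => by
    rcases le_or_gt c 0 with hc | hc
    · have : 0 ≤ S / 8 * (c * c) := mul_nonneg (by linarith) (mul_self_nonneg c)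
      nlinarith
    · linarith [h c hc]
  have hdiscrim := discrim_le_zero hquad
  rw [discrim] at hdiscrim
  linarith

end RealInequalities

section Conditioning

variable {Ω : Type*} {m m' n mΩ : MeasurableSpace Ω} {μ : Measure Ω}

lemma memLp_top_exp {f : Ω → ℝ} (hf : MemLp f ⊤ μ) : MemLp (fun ω => Real.exp (f ω)) ⊤ μ := by
  refine memLp_top_of_bound (Real.continuous_exp.comp_aestronglyMeasurable hf.1)
    (Real.exp (lpNorm f ⊤ μ)) ?_
  filter_upwards [ae_le_lpNorm_exponent_top hf] with ω h
  rw [Real.norm_eq_abs, Real.abs_exp]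
  exact Real.exp_le_exp.2 ((le_abs_self _).trans h)

lemma memLp_top_negMulLog {f : Ω → ℝ} (hf : AEStronglyMeasurable f μ)
    (h : ∀ᵐ ω ∂μ, f ω ∈ Set.Icc 0 1) : MemLp (fun ω => Real.negMulLog (f ω)) ⊤ μ := by
  obtain ⟨C, hC⟩ := isCompact_Icc.exists_bound_of_continuousOn
    (Real.continuous_negMulLog.continuousOn (s := Set.Icc 0 1))
  exact memLp_top_of_bound (Real.continuous_negMulLog.comp_aestronglyMeasurable hf) C
    (h.mono fun ω hω => hC _ hω)

lemma condExp_ae_mem_Icc {f : Ω → ℝ} (h : ∀ᵐ ω ∂μ, f ω ∈ Set.Icc 0 1) :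
    ∀ᵐ ω ∂μ, (μ[f | m]) ω ∈ Set.Icc (0 : ℝ) 1 := by
  filter_upwards [condExp_nonneg (m := m) (h.mono fun ω hω => hω.1),
    condExp_le_nonneg_const (m := m) zero_le_one (h.mono fun ω hω => hω.2)] with ω h0 h1
  exact ⟨h0, h1⟩

lemma memLp_top_condExp {f : Ω → ℝ} (hf : MemLp f ⊤ μ) : MemLp (μ[f | m]) ⊤ μ :=
  hf.condExp le_top

lemma memLp_top_mul_sub_sq_div {y l : Ω → ℝ} (hy : MemLp y ⊤ μ) (hl : MemLp l ⊤ μ) :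
    MemLp (fun ω => l ω * y ω - l ω ^ 2 / 8) ⊤ μ := by
  have hl2 : MemLp (l * l) ⊤ μ := hl.mul hl
  have hly : MemLp (l * y) ⊤ μ := hy.mul hl
  refine (hly.sub (hl2.const_mul 8⁻¹)).ae_eq (.of_forall fun ω => ?_)
  simp only [Pi.sub_apply, Pi.mul_apply]
  ring

variable [IsProbabilityMeasure μ]

lemma integrable_div_of_ae_le {p q : Ω → ℝ} (hpm : AEStronglyMeasurable p μ)
    (hqm : AEStronglyMeasurable q μ) (hp : 0 ≤ᵐ[μ] p) (hpq : p ≤ᵐ[μ] q) :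
    Integrable (fun ω => p ω / q ω) μ := by
  refine (memLp_of_bounded (a := 0) (b := 1) ?_ (hpm.div₀ hqm) ⊤).integrable le_top
  filter_upwards [hp, hpq] with ω hp hpq
  exact ⟨div_nonneg hp (hp.trans hpq), div_le_one_of_le₀ hpq (hp.trans hpq)⟩

lemma integral_condExp_mul (hm : m ≤ mΩ) {f g : Ω → ℝ} (hf : MemLp f ⊤ μ) (hg : MemLp g ⊤ μ)
    (hgm : StronglyMeasurable[m] g) :
    ∫ ω, (μ[f | m]) ω * g ω ∂μ = ∫ ω, f ω * g ω ∂μ := by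
  have hfg : MemLp (f * g) ⊤ μ := hg.mul hf
  have h := condExp_mul_of_stronglyMeasurable_right hgm (hfg.integrable le_top)
    (hf.integrable le_top)
  exact (integral_congr_ae h).symm.trans (integral_condExp hm)

lemma condExp_mul_of_condExp_ae_eq (hmn : m ≤ n) (hn : n ≤ mΩ) {o q f : Ω → ℝ}
    (ho : MemLp o ⊤ μ) (hoq : μ[o | n] =ᵐ[μ] q) (hqm : StronglyMeasurable[m] q)
    (hf : MemLp f ⊤ μ) (hfn : StronglyMeasurable[n] f) : μ[o * f | m] =ᵐ[μ] q * μ[f | m] := by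
  have hq : MemLp q ⊤ μ := (memLp_congr_ae hoq).1 (memLp_top_condExp ho)
  have hof : MemLp (o * f) ⊤ μ := hf.mul ho
  have hqf : MemLp (q * f) ⊤ μ := hf.mul hq
  calc μ[o * f | m] =ᵐ[μ] μ[μ[o * f | n] | m] := (condExp_condExp_of_le hmn hn).symm
    _ =ᵐ[μ] μ[q * f | m] := condExp_congr_ae <|
        (condExp_mul_of_stronglyMeasurable_right hfn (hof.integrable le_top)
          (ho.integrable le_top)).trans (hoq.mul .rfl)
    _ =ᵐ[μ] q * μ[f | m] := condExp_mul_of_stronglyMeasurable_left hqm (hqf.integrable le_top)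
        (hf.integrable le_top)

lemma condExp_add_mul_of_stronglyMeasurable (hm : m ≤ mΩ) {u v f : Ω → ℝ} (hu : MemLp u ⊤ μ)
    (hum : StronglyMeasurable[m] u) (hv : MemLp v ⊤ μ) (hvm : StronglyMeasurable[m] v)
    (hf : MemLp f ⊤ μ) : μ[u + f * v | m] =ᵐ[μ] u + μ[f | m] * v := by
  have hfv : MemLp (f * v) ⊤ μ := hv.mul hf
  refine (condExp_add (hu.integrable le_top) (hfv.integrable le_top) m).trans ?_
  rw [condExp_of_stronglyMeasurable hm hum (hu.integrable le_top)]
  exact .add .rfl (condExp_mul_of_stronglyMeasurable_right hvm (hfv.integrable le_top)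
    (hf.integrable le_top))

/-- The chord bound for `exp` on the range of `y` reduces this to a Bernoulli distribution with the
same conditional mean. -/
lemma condExp_exp_mul_sub_condExp_le (hm : m ≤ mΩ) {y l : Ω → ℝ} (hy : AEStronglyMeasurable y μ)
    (hy01 : ∀ᵐ ω ∂μ, y ω ∈ Set.Icc 0 1) (hl : MemLp l ⊤ μ) (hlm : StronglyMeasurable[m] l) :
    μ[fun ω => Real.exp (l ω * (y ω - (μ[y | m]) ω)) | m] ≤ᵐ[μ]
      fun ω => Real.exp (l ω ^ 2 / 8) := by
  set e := μ[y | m]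
  have hyL : MemLp y ⊤ μ := memLp_of_bounded hy01 hy ⊤
  have heL : MemLp e ⊤ μ := memLp_top_condExp hyL
  have hem : StronglyMeasurable[m] e := stronglyMeasurable_condExp
  let u : Ω → ℝ := fun ω => Real.exp (-l ω * e ω)
  let v : Ω → ℝ := fun ω => Real.exp (l ω * (1 - e ω)) - u ω
  have hu : MemLp u ⊤ μ := memLp_top_exp (heL.mul hl.neg)
  have hum : StronglyMeasurable[m] u :=
    Real.continuous_exp.comp_stronglyMeasurable (hlm.neg.mul hem)
  have hv : MemLp v ⊤ μ := (memLp_top_exp (((memLp_const 1).sub heL).mul hl)).sub hu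
  have hvm : StronglyMeasurable[m] v := (Real.continuous_exp.comp_stronglyMeasurable
    (hlm.mul (stronglyMeasurable_const.sub hem))).sub hum
  have hchord : (fun ω => Real.exp (l ω * (y ω - e ω))) ≤ᵐ[μ] u + y * v := by
    filter_upwards [hy01] with ω hω
    convert exp_add_mul_sub_le hω (-l ω * e ω) (l ω * (1 - e ω)) using 2
    · ring
    · rfl
  refine (condExp_mono ((memLp_top_exp ((hyL.sub heL).mul hl)).integrable le_top)
    ((hu.add (hv.mul hyL)).integrable le_top) hchord).trans ?_
  filter_upwards [condExp_add_mul_of_stronglyMeasurable hm hu hum hv hvm hyL,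
    condExp_ae_mem_Icc (m := m) hy01] with ω hω he
  rw [hω]
  calc u ω + e ω * v ω = (1 - e ω) * Real.exp (-l ω * e ω) + e ω * Real.exp (l ω * (1 - e ω)) := by
        simp only [u, v]
        ring
    _ ≤ Real.exp (l ω ^ 2 / 8) := hoeffding_bernoulli (l ω) he

lemma condExp_exp_mul_sub_condExp_sub_sq_le_one (hm : m ≤ mΩ) {y l : Ω → ℝ}
    (hy : AEStronglyMeasurable y μ) (hy01 : ∀ᵐ ω ∂μ, y ω ∈ Set.Icc 0 1) (hl : MemLp l ⊤ μ)
    (hlm : StronglyMeasurable[m] l) :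
    μ[fun ω => Real.exp (l ω * (y ω - (μ[y | m]) ω) - l ω ^ 2 / 8) | m] ≤ᵐ[μ] 1 := by
  have hyL : MemLp y ⊤ μ := memLp_of_bounded hy01 hy ⊤
  have hsub : MemLp (fun ω => y ω - (μ[y | m]) ω) ⊤ μ := hyL.sub (memLp_top_condExp hyL)
  have hprod : (fun ω => Real.exp (l ω * (y ω - (μ[y | m]) ω) - l ω ^ 2 / 8)) =
      (fun ω => Real.exp (l ω * (y ω - (μ[y | m]) ω))) * fun ω => Real.exp (-(l ω ^ 2 / 8)) := by
    ext ω
    simp [sub_eq_add_neg, Real.exp_add]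
  have hpull := condExp_mul_of_stronglyMeasurable_right (m := m)
    (f := fun ω => Real.exp (l ω * (y ω - (μ[y | m]) ω))) (g := fun ω => Real.exp (-(l ω ^ 2 / 8)))
    ((by fun_prop : Continuous fun x : ℝ => Real.exp (-(x ^ 2 / 8))).comp_stronglyMeasurable hlm)
    (hprod ▸ (memLp_top_exp (memLp_top_mul_sub_sq_div hsub hl)).integrable le_top)
    ((memLp_top_exp (hsub.mul hl)).integrable le_top)
  rw [hprod]
  filter_upwards [hpull, condExp_exp_mul_sub_condExp_le hm hy hy01 hl hlm] with ω hω hle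
  rw [hω, Pi.mul_apply, Real.exp_neg, ← div_eq_mul_inv, Pi.one_apply]
  exact div_le_one_of_le₀ hle (Real.exp_nonneg _)

/-- Thinning: revealing a quantity with conditional probability `q` preserves the normalisation of
its exponential, because `exp (o * z) ≤ 1 + o * (exp z - 1)` for `o ∈ [0, 1]`. -/
lemma condExp_exp_mul_le_one (hmn : m ≤ n) (hn : n ≤ mΩ) {o q z : Ω → ℝ}
    (ho : AEStronglyMeasurable o μ) (ho01 : ∀ᵐ ω ∂μ, o ω ∈ Set.Icc 0 1) (hoq : μ[o | n] =ᵐ[μ] q)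
    (hqm : StronglyMeasurable[m] q) (hz : MemLp z ⊤ μ) (hzn : StronglyMeasurable[n] z)
    (hexp : μ[fun ω => Real.exp (z ω) | m] ≤ᵐ[μ] 1) :
    μ[fun ω => Real.exp (o ω * z ω) | m] ≤ᵐ[μ] 1 := by
  have hm := hmn.trans hn
  have hoL : MemLp o ⊤ μ := memLp_of_bounded ho01 ho ⊤
  let E : Ω → ℝ := fun ω => Real.exp (z ω)
  have hoz : MemLp (fun ω => Real.exp (o ω * z ω)) ⊤ μ := memLp_top_exp (hz.mul hoL)
  have hE : MemLp E ⊤ μ := memLp_top_exp hz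
  have hf : MemLp (E - fun _ => 1) ⊤ μ := hE.sub (memLp_const 1)
  have hfn : StronglyMeasurable[n] (E - fun _ => 1) :=
    (Real.continuous_exp.comp_stronglyMeasurable hzn).sub stronglyMeasurable_const
  have hof : MemLp (o * (E - fun _ => 1)) ⊤ μ := hf.mul hoL
  have hchord : (fun ω => Real.exp (o ω * z ω)) ≤ᵐ[μ] (fun _ => 1) + o * (E - fun _ => 1) := by
    filter_upwards [ho01] with ω hω
    simpa using! exp_add_mul_sub_le hω 0 (z ω)
  refine (condExp_mono (hoz.integrable le_top)
    ((integrable_const 1).add (hof.integrable le_top)) hchord).trans ?_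
  filter_upwards [condExp_add (integrable_const (1 : ℝ)) (hof.integrable le_top) m,
    condExp_mul_of_condExp_ae_eq hmn hn hoL hoq hqm hf hfn,
    condExp_sub (hE.integrable le_top) (integrable_const (1 : ℝ)) m, hexp, hoq,
    condExp_ae_mem_Icc (m := n) ho01] with ω hadd hmul hsub hexp hoq hq
  rw [hoq] at hq
  rw [hadd, Pi.add_apply, condExp_const hm, hmul, Pi.mul_apply, hsub, Pi.sub_apply,
    condExp_const hm, Pi.one_apply]
  exact add_le_of_nonpos_right (mul_nonpos_of_nonneg_of_nonpos hq.1 (sub_nonpos.2 hexp))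

lemma memLp_top_log_add {p : Ω → ℝ} (hp : AEStronglyMeasurable p μ)
    (hp01 : ∀ᵐ ω ∂μ, p ω ∈ Set.Icc 0 1) {δ : ℝ} (hδ : 0 < δ) :
    MemLp (fun ω => Real.log (p ω + δ)) ⊤ μ := by
  have hlog : ∀ᵐ ω ∂μ, Real.log (p ω + δ) ∈ Set.Icc (Real.log δ) (Real.log (1 + δ)) := by
    filter_upwards [hp01] with ω hω
    exact ⟨Real.log_le_log hδ (by linarith [hω.1]),
      Real.log_le_log (by linarith [hω.1]) (by linarith [hω.2])⟩
  exact memLp_of_bounded hlog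
    (Real.measurable_log.comp_aemeasurable (hp.aemeasurable.add_const δ)).aestronglyMeasurable ⊤

lemma integral_exp_add_le (hm : m ≤ mΩ) {w x : Ω → ℝ} (hw : MemLp w ⊤ μ)
    (hwm : StronglyMeasurable[m] w) (hx : MemLp x ⊤ μ)
    (hexp : μ[fun ω => Real.exp (x ω) | m] ≤ᵐ[μ] 1) :
    ∫ ω, Real.exp (w ω + x ω) ∂μ ≤ ∫ ω, Real.exp (w ω) ∂μ := by
  have hW : MemLp (fun ω => Real.exp (w ω)) ⊤ μ := memLp_top_exp hw
  have hX : MemLp (fun ω => Real.exp (x ω)) ⊤ μ := memLp_top_exp hx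
  have hXW : MemLp (fun ω => (μ[fun ω => Real.exp (x ω) | m]) ω * Real.exp (w ω)) ⊤ μ :=
    hW.mul (memLp_top_condExp hX)
  calc ∫ ω, Real.exp (w ω + x ω) ∂μ
      = ∫ ω, (μ[fun ω => Real.exp (x ω) | m]) ω * Real.exp (w ω) ∂μ := by
        rw [integral_condExp_mul hm hX hW (Real.continuous_exp.comp_stronglyMeasurable hwm)]
        simp only [Real.exp_add, mul_comm]
    _ ≤ ∫ ω, Real.exp (w ω) ∂μ := by
        refine integral_mono_ae (hXW.integrable le_top) (hW.integrable le_top) ?_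
        filter_upwards [hexp] with ω hω
        exact mul_le_of_le_one_left (Real.exp_nonneg _) hω

lemma integral_negMulLog_add_integral_mul_le (hmm' : m ≤ m') (hm' : m' ≤ mΩ) {b w x : Ω → ℝ}
    (hb : AEStronglyMeasurable b μ) (hb01 : ∀ᵐ ω ∂μ, b ω ∈ Set.Icc 0 1) (hw : MemLp w ⊤ μ)
    (hwm : StronglyMeasurable[m] w) (hx : MemLp x ⊤ μ) (hxm' : StronglyMeasurable[m'] x)
    (hexp : μ[fun ω => Real.exp (x ω) | m] ≤ᵐ[μ] 1) :
    ∫ ω, Real.negMulLog ((μ[b | m']) ω) ∂μ + ∫ ω, b ω * (1 + (w ω + x ω)) ∂μ ≤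
      ∫ ω, Real.exp (w ω) ∂μ := by
  have hbL : MemLp b ⊤ μ := memLp_of_bounded hb01 hb ⊤
  have hp := condExp_ae_mem_Icc (m := m') hb01
  have hpL : MemLp (μ[b | m']) ⊤ μ := memLp_top_condExp hbL
  have hnegL := memLp_top_negMulLog hpL.1 hp
  have hwx : MemLp (fun ω => w ω + x ω) ⊤ μ := hw.add hx
  have hyL : MemLp (fun ω => 1 + (w ω + x ω)) ⊤ μ := (memLp_const (1 : ℝ)).add hwx
  have hpyL : MemLp (fun ω => (μ[b | m']) ω * (1 + (w ω + x ω))) ⊤ μ := hyL.mul hpL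
  refine le_trans ?_ (integral_exp_add_le (hmm'.trans hm') hw hwm hx hexp)
  rw [← integral_condExp_mul hm' hbL hyL
      (stronglyMeasurable_const.add ((hwm.mono hmm').add hxm')),
    ← integral_add (hnegL.integrable le_top) (hpyL.integrable le_top)]
  refine integral_mono_ae ((hnegL.add hpyL).integrable le_top)
    ((memLp_top_exp hwx).integrable le_top) ?_
  filter_upwards [hp] with ω hω
  exact negMulLog_add_mul_one_add_le_exp hω.1 _

/-- A Donsker–Varadhan inequality. Its extremal dual variable is `log p + x`; as `log p` may be
unbounded, the proof uses `log (p + δ) + x`. -/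
lemma integral_mul_le_integral_negMulLog_sub (hmm' : m ≤ m') (hm' : m' ≤ mΩ) {b x : Ω → ℝ}
    (hb : AEStronglyMeasurable b μ) (hb01 : ∀ᵐ ω ∂μ, b ω ∈ Set.Icc 0 1) (hx : MemLp x ⊤ μ)
    (hxm' : StronglyMeasurable[m'] x) (hexp : μ[fun ω => Real.exp (x ω) | m] ≤ᵐ[μ] 1) :
    ∫ ω, b ω * x ω ∂μ ≤
      ∫ ω, Real.negMulLog ((μ[b | m]) ω) ∂μ - ∫ ω, Real.negMulLog ((μ[b | m']) ω) ∂μ := by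
  have hm := hmm'.trans hm'
  have hbL : MemLp b ⊤ μ := memLp_of_bounded hb01 hb ⊤
  set p := μ[b | m]
  have hpL : MemLp p ⊤ μ := memLp_top_condExp hbL
  have hp : ∀ᵐ ω ∂μ, p ω ∈ Set.Icc 0 1 := condExp_ae_mem_Icc hb01
  have hpm : StronglyMeasurable[m] p := stronglyMeasurable_condExp
  have hnegL : MemLp (fun ω => Real.negMulLog (p ω)) ⊤ μ := memLp_top_negMulLog hpL.1 hp
  have hbx : MemLp (fun ω => b ω * x ω) ⊤ μ := hx.mul hbL
  refine le_of_forall_pos_le_add fun δ hδ => ?_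
  let w : Ω → ℝ := fun ω => Real.log (p ω + δ)
  have hwL : MemLp w ⊤ μ := memLp_top_log_add hpL.1 hp hδ
  have hwm : StronglyMeasurable[m] w :=
    (Real.measurable_log.comp (hpm.measurable.add_const δ)).stronglyMeasurable
  have hw1L : MemLp (fun ω => 1 + w ω) ⊤ μ := (memLp_const (1 : ℝ)).add hwL
  have hbw : MemLp (fun ω => b ω * (1 + w ω)) ⊤ μ := hw1L.mul hbL
  have hpw : MemLp (fun ω => p ω * (1 + w ω)) ⊤ μ := hw1L.mul hpL
  have hnegδ : MemLp (fun ω => Real.negMulLog (p ω) + δ) ⊤ μ := hnegL.add (memLp_const δ)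
  have hvar := integral_negMulLog_add_integral_mul_le hmm' hm' hb hb01 hwL hwm hx hxm' hexp
  have hsplit : ∫ ω, b ω * (1 + (w ω + x ω)) ∂μ =
      ∫ ω, p ω * (1 + w ω) ∂μ + ∫ ω, b ω * x ω ∂μ := by
    rw [integral_condExp_mul hm hbL hw1L (stronglyMeasurable_const.add hwm),
      ← integral_add (hbw.integrable le_top) (hbx.integrable le_top)]
    exact integral_congr_ae (.of_forall fun ω => by ring)
  have hlog : ∫ ω, Real.exp (w ω) ∂μ ≤
      ∫ ω, p ω * (1 + w ω) ∂μ + (∫ ω, Real.negMulLog (p ω) ∂μ + δ) := by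
    calc ∫ ω, Real.exp (w ω) ∂μ
        ≤ ∫ ω, (p ω * (1 + w ω) + (Real.negMulLog (p ω) + δ)) ∂μ := by
          refine integral_mono_ae ((memLp_top_exp hwL).integrable le_top)
            ((hpw.add hnegδ).integrable le_top) ?_
          filter_upwards [hp] with ω hω
          simp only [w, Real.exp_log (add_pos_of_nonneg_of_pos hω.1 hδ)]
          exact self_add_le_mul_one_add_log_add hω.1 hδ.le
      _ = _ := by
          rw [integral_add (hpw.integrable le_top) (hnegδ.integrable le_top),
            integral_add (hnegL.integrable le_top) (integrable_const δ)]
          simp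
  linarith

/-- Partial disclosure of the quantity `y`. In passing from the information `m` to `m'`, the value
of `y` is revealed with the weight `o` (the indicator of the event that `y` is observed), whose
conditional mean `q` given `m` does not change when the larger information `n`, which
contains `y`, is given. -/
structure Disclosure (μ : Measure Ω) (m m' n : MeasurableSpace Ω) (y o q : Ω → ℝ) : Prop where
  le_after : m ≤ m'
  after_le : m' ≤ mΩ
  le_full : m ≤ n
  full_le : n ≤ mΩ
  value_measurable : StronglyMeasurable[n] y
  value_mem_Icc : ∀ᵐ ω ∂μ, y ω ∈ Set.Icc 0 1
  weight_measurable : StronglyMeasurable[m'] o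
  weight_mem_Icc : ∀ᵐ ω ∂μ, o ω ∈ Set.Icc 0 1
  observed_measurable : StronglyMeasurable[m'] (o * y)
  prob_measurable : StronglyMeasurable[m] q
  condExp_weight : μ[o | n] =ᵐ[μ] q

namespace Disclosure

variable {y o q b : Ω → ℝ}

omit [IsProbabilityMeasure μ] in
lemma le_space (h : Disclosure μ m m' n y o q) : m ≤ mΩ :=
  h.le_full.trans h.full_le

omit [IsProbabilityMeasure μ] in
lemma aestronglyMeasurable_value (h : Disclosure μ m m' n y o q) : AEStronglyMeasurable y μ :=
  (h.value_measurable.mono h.full_le).aestronglyMeasurable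

omit [IsProbabilityMeasure μ] in
lemma aestronglyMeasurable_weight (h : Disclosure μ m m' n y o q) : AEStronglyMeasurable o μ :=
  (h.weight_measurable.mono h.after_le).aestronglyMeasurable

lemma memLp_weight (h : Disclosure μ m m' n y o q) : MemLp o ⊤ μ :=
  memLp_of_bounded h.weight_mem_Icc h.aestronglyMeasurable_weight ⊤

lemma memLp_prob (h : Disclosure μ m m' n y o q) : MemLp q ⊤ μ :=
  (memLp_congr_ae h.condExp_weight).1 (memLp_top_condExp h.memLp_weight)

lemma memLp_value_sub_condExp (h : Disclosure μ m m' n y o q) :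
    MemLp (fun ω => y ω - (μ[y | m]) ω) ⊤ μ :=
  have hy : MemLp y ⊤ μ := memLp_of_bounded h.value_mem_Icc h.aestronglyMeasurable_value ⊤
  hy.sub (memLp_top_condExp hy)

lemma integral_mul_mul_sub_sq_le (h : Disclosure μ m m' n y o q) (hbn : StronglyMeasurable[n] b)
    (hb01 : ∀ᵐ ω ∂μ, b ω ∈ Set.Icc 0 1) {l : Ω → ℝ} (hl : MemLp l ⊤ μ)
    (hlm : StronglyMeasurable[m] l) :
    ∫ ω, b ω * (q ω * (l ω * (y ω - (μ[y | m]) ω) - l ω ^ 2 / 8)) ∂μ ≤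
      ∫ ω, Real.negMulLog ((μ[b | m]) ω) ∂μ - ∫ ω, Real.negMulLog ((μ[b | m']) ω) ∂μ := by
  set e := μ[y | m]
  have hem : StronglyMeasurable[m] e := stronglyMeasurable_condExp
  have hb := (hbn.mono h.full_le).aestronglyMeasurable (μ := μ)
  let z : Ω → ℝ := fun ω => l ω * (y ω - e ω) - l ω ^ 2 / 8
  have hz : MemLp z ⊤ μ := memLp_top_mul_sub_sq_div h.memLp_value_sub_condExp hl
  have hl2m : StronglyMeasurable[m] fun ω => l ω ^ 2 / 8 :=
    (by fun_prop : Continuous fun x : ℝ => x ^ 2 / 8).comp_stronglyMeasurable hlm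
  have hzn : StronglyMeasurable[n] z := ((hlm.mono h.le_full).mul
    (h.value_measurable.sub (hem.mono h.le_full))).sub (hl2m.mono h.le_full)
  have hoz : MemLp (fun ω => o ω * z ω) ⊤ μ := hz.mul h.memLp_weight
  have hozm' : StronglyMeasurable[m'] fun ω => o ω * z ω := by
    have hoz_eq : (fun ω => o ω * z ω) =
        fun ω => l ω * (o * y) ω - o ω * (l ω * e ω + l ω ^ 2 / 8) := by
      ext ω
      simp only [z, Pi.mul_apply]
      ring
    rw [hoz_eq]
    exact ((hlm.mono h.le_after).mul h.observed_measurable).sub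
      (h.weight_measurable.mul (((hlm.mul hem).add hl2m).mono h.le_after))
  have hbz : MemLp (fun ω => b ω * z ω) ⊤ μ := hz.mul (memLp_of_bounded hb01 hb ⊤)
  calc ∫ ω, b ω * (q ω * z ω) ∂μ = ∫ ω, (μ[o | n]) ω * (b ω * z ω) ∂μ := by
        refine integral_congr_ae ?_
        filter_upwards [h.condExp_weight] with ω hω
        rw [hω]
        ring
    _ = ∫ ω, b ω * (o ω * z ω) ∂μ := by
        rw [integral_condExp_mul h.full_le h.memLp_weight hbz (hbn.mul hzn)]
        simp only [mul_left_comm]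
    _ ≤ _ := integral_mul_le_integral_negMulLog_sub h.le_after h.after_le hb hb01 hoz hozm' <|
        condExp_exp_mul_le_one h.le_full h.full_le h.aestronglyMeasurable_weight h.weight_mem_Icc
          h.condExp_weight h.prob_measurable hz hzn <|
        condExp_exp_mul_sub_condExp_sub_sq_le_one h.le_space h.aestronglyMeasurable_value
          h.value_mem_Icc hl hlm

/-- `r` is a bounded approximation of `1 / q`. -/
lemma mul_integral_mul_sub_condExp_le_add (h : Disclosure μ m m' n y o q)
    (hbn : StronglyMeasurable[n] b) (hb01 : ∀ᵐ ω ∂μ, b ω ∈ Set.Icc 0 1) {r : Ω → ℝ}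
    (hr : MemLp r ⊤ μ) (hrm : StronglyMeasurable[m] r) (hqr : ∀ᵐ ω ∂μ, q ω * r ω ≤ 1) {c : ℝ}
    (hc : 0 ≤ c) :
    c * ∫ ω, b ω * (y ω - (μ[y | m]) ω) ∂μ ≤
      ∫ ω, Real.negMulLog ((μ[b | m]) ω) ∂μ - ∫ ω, Real.negMulLog ((μ[b | m']) ω) ∂μ +
        ∫ ω, (μ[b | m]) ω * (q ω * (c * r ω) ^ 2 / 8 + c * (1 - q ω * r ω)) ∂μ := by
  have hb : MemLp b ⊤ μ :=
    memLp_of_bounded hb01 (hbn.mono h.full_le).aestronglyMeasurable ⊤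
  have hqrL : MemLp (q * r) ⊤ μ := hr.mul h.memLp_prob
  have hl : MemLp (fun ω => c * r ω) ⊤ μ := hr.const_mul c
  let x : Ω → ℝ := fun ω => q ω * (c * r ω * (y ω - (μ[y | m]) ω) - (c * r ω) ^ 2 / 8)
  have hx : MemLp x ⊤ μ :=
    (memLp_top_mul_sub_sq_div h.memLp_value_sub_condExp hl).mul h.memLp_prob
  let s : Ω → ℝ := fun ω => q ω * (c * r ω) ^ 2 / 8 + c * (1 - q ω * r ω)
  have hs : MemLp s ⊤ μ := by
    have hs_eq : s = (8⁻¹ * c ^ 2) • ((q * r) * r) + c • ((fun _ => 1) - q * r) := by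
      ext ω
      simp only [s, Pi.add_apply, Pi.smul_apply, Pi.sub_apply, Pi.mul_apply, smul_eq_mul]
      ring
    have hqrr : MemLp (q * r * r) ⊤ μ := hr.mul hqrL
    rw [hs_eq]
    exact (hqrr.const_smul _).add (((memLp_const (1 : ℝ)).sub hqrL).const_smul c)
  have hsm : StronglyMeasurable[m] s :=
    (by fun_prop : Continuous fun v : ℝ × ℝ => v.1 * (c * v.2) ^ 2 / 8 + c * (1 - v.1 * v.2))
      |>.comp_stronglyMeasurable (h.prob_measurable.prodMk hrm)
  have hbx : MemLp (fun ω => b ω * x ω) ⊤ μ := hx.mul hb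
  have hbs : MemLp (fun ω => b ω * s ω) ⊤ μ := hs.mul hb
  have hby : MemLp (fun ω => b ω * (y ω - (μ[y | m]) ω)) ⊤ μ := h.memLp_value_sub_condExp.mul hb
  calc c * ∫ ω, b ω * (y ω - (μ[y | m]) ω) ∂μ = ∫ ω, c * (b ω * (y ω - (μ[y | m]) ω)) ∂μ :=
        (integral_const_mul _ _).symm
    _ ≤ ∫ ω, (b ω * x ω + b ω * s ω) ∂μ := by
        refine integral_mono_ae ((hby.const_mul c).integrable le_top)
          ((hbx.add hbs).integrable le_top) ?_
        filter_upwards [hb01, h.value_mem_Icc, condExp_ae_mem_Icc (m := m) h.value_mem_Icc, hqr]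
          with ω hb hy he hqr
        have hnonneg := mul_nonneg (mul_nonneg hc hb.1) (mul_nonneg (sub_nonneg.2 hqr)
          (by linarith [hy.2, he.1] : 0 ≤ 1 - (y ω - (μ[y | m]) ω)))
        simp only [x, s]
        linarith
    _ = ∫ ω, b ω * x ω ∂μ + ∫ ω, (μ[b | m]) ω * s ω ∂μ := by
        rw [integral_add (hbx.integrable le_top) (hbs.integrable le_top),
          integral_condExp_mul h.le_space hb hs hsm]
    _ ≤ _ := by
        gcongr
        exact h.integral_mul_mul_sub_sq_le hbn hb01 hl (hrm.const_mul c)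

/-- The slope `c / q` may be unbounded, so the proof uses the slopes `c / (q + δ / c)`. -/
lemma mul_integral_mul_sub_condExp_le (h : Disclosure μ m m' n y o q)
    (hbn : StronglyMeasurable[n] b) (hb01 : ∀ᵐ ω ∂μ, b ω ∈ Set.Icc 0 1) (hbq : μ[b | m] ≤ᵐ[μ] q)
    {c : ℝ} (hc : 0 < c) :
    c * ∫ ω, b ω * (y ω - (μ[y | m]) ω) ∂μ ≤
      ∫ ω, Real.negMulLog ((μ[b | m]) ω) ∂μ - ∫ ω, Real.negMulLog ((μ[b | m']) ω) ∂μ +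
        c ^ 2 / 8 * ∫ ω, (μ[b | m]) ω / q ω ∂μ := by
  have hp : ∀ᵐ ω ∂μ, (μ[b | m]) ω ∈ Set.Icc 0 1 := condExp_ae_mem_Icc hb01
  refine le_of_forall_pos_le_add fun δ hδ => ?_
  have hε : 0 < δ / c := div_pos hδ hc
  let r : Ω → ℝ := fun ω => (q ω + δ / c)⁻¹
  have hrm : StronglyMeasurable[m] r :=
    (h.prob_measurable.measurable.add_const _).inv.stronglyMeasurable
  have hr : MemLp r ⊤ μ := by
    refine memLp_of_bounded (a := 0) (b := (δ / c)⁻¹) ?_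
      (hrm.mono h.le_space).aestronglyMeasurable ⊤
    filter_upwards [hp, hbq] with ω hp hpq
    have hq := hp.1.trans hpq
    exact ⟨by positivity, inv_anti₀ hε (le_add_of_nonneg_left hq)⟩
  have hqr : ∀ᵐ ω ∂μ, q ω * r ω ≤ 1 := by
    filter_upwards [hp, hbq] with ω hp hpq
    exact mul_inv_le_one_of_le₀ (le_add_of_nonneg_right hε.le) (by linarith [hp.1])
  have hpq : Integrable (fun ω => (μ[b | m]) ω / q ω) μ :=
    integrable_div_of_ae_le integrable_condExp.aestronglyMeasurable
      h.memLp_prob.aestronglyMeasurable (hp.mono fun ω h => h.1) hbq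
  refine (h.mul_integral_mul_sub_condExp_le_add hbn hb01 hr hrm hqr hc.le).trans ?_
  rw [add_assoc]
  gcongr
  calc ∫ ω, (μ[b | m]) ω * (q ω * (c * r ω) ^ 2 / 8 + c * (1 - q ω * r ω)) ∂μ
      ≤ ∫ ω, (c ^ 2 / 8 * ((μ[b | m]) ω / q ω) + c * (δ / c)) ∂μ := by
        refine integral_mono_of_nonneg ?_ ((hpq.const_mul _).add (integrable_const _)) ?_
        · filter_upwards [hp, hbq, hqr] with ω hp hpq hqr
          have := sub_nonneg.2 hqr
          have := hp.1
          have := hp.1.trans hpq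
          simp only [Pi.zero_apply]
          positivity
        · filter_upwards [hp, hbq] with ω hp hpq
          exact mul_cutoff_le hp.1 hpq hε hc.le
    _ = c ^ 2 / 8 * ∫ ω, (μ[b | m]) ω / q ω ∂μ + δ := by
        rw [integral_add (hpq.const_mul _) (integrable_const _), integral_const_mul,
          mul_div_cancel₀ δ hc.ne']
        simp

end Disclosure

end Conditioning

section Rounds

variable {Ω V : Type*} {m m' n mΩ : MeasurableSpace Ω} {μ : Measure Ω} [Fintype V]

lemma shannonEntropy_eq_sum_negMulLog (p : V → ℝ) :
    shannonEntropy p = ∑ a, Real.negMulLog (p a) := by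
  simp [shannonEntropy, Real.negMulLog]

/-- The conditional entropy of the finite-valued random variable `X` given the σ-algebra `m`: the
expected Shannon entropy of its conditional law. -/
noncomputable def condEntropy (μ : Measure Ω) (X : Ω → V) (m : MeasurableSpace Ω) : ℝ :=
  ∫ ω, shannonEntropy (fun a => (μ⟦X ⁻¹' {a} | m⟧) ω) ∂μ

omit [Fintype V] in
lemma indicator_one_mem_Icc (s : Set Ω) (ω : Ω) : s.indicator (fun _ => (1 : ℝ)) ω ∈ I :=
  ⟨Set.indicator_nonneg (fun _ _ => zero_le_one) ω,
    Set.indicator_le_self' (fun _ _ => zero_le_one) ω⟩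

omit [Fintype V] in
lemma condProb_ae_mem_Icc (s : Set Ω) : ∀ᵐ ω ∂μ, (μ⟦s | m⟧) ω ∈ I :=
  condExp_ae_mem_Icc (.of_forall (indicator_one_mem_Icc s))

omit [Fintype V] in
lemma memLp_top_condProb [IsProbabilityMeasure μ] {s : Set Ω} (hs : MeasurableSet s) :
    MemLp (μ⟦s | m⟧) ⊤ μ :=
  memLp_top_condExp ((memLp_const 1).indicator hs)

omit [Fintype V] in
lemma ae_forall_condProb_preimage_mem_Icc [Finite V] (X : Ω → V) :
    ∀ᵐ ω ∂μ, ∀ a, (μ⟦X ⁻¹' {a} | m⟧) ω ∈ I :=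
  ae_all_iff.2 fun _ => condProb_ae_mem_Icc _

lemma condProb_le_sum_revealers (G : Digraph V) (X : Ω → V) (a : V) :
    μ⟦X ⁻¹' {a} | m⟧ ≤ᵐ[μ] ∑ k ∈ revealers G a, μ⟦X ⁻¹' {k} | m⟧ := by
  filter_upwards [ae_forall_condProb_preimage_mem_Icc X] with ω hω
  rw [Finset.sum_apply]
  exact Finset.single_le_sum (f := fun k => (μ⟦X ⁻¹' {k} | m⟧) ω) (fun k _ => (hω k).1)
    (self_mem_revealers G a)

lemma sum_integral_condProb_div_le_mas [IsProbabilityMeasure μ] (G : Digraph V) (X : Ω → V) :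
    ∑ a, ∫ ω, (μ⟦X ⁻¹' {a} | m⟧) ω / (∑ k ∈ revealers G a, μ⟦X ⁻¹' {k} | m⟧) ω ∂μ ≤ mas G := by
  have hint : ∀ a, Integrable
      (fun ω => (μ⟦X ⁻¹' {a} | m⟧) ω / (∑ k ∈ revealers G a, μ⟦X ⁻¹' {k} | m⟧) ω) μ := fun a =>
    integrable_div_of_ae_le integrable_condExp.aestronglyMeasurable
      (integrable_finsetSum' _ fun _ _ => integrable_condExp).aestronglyMeasurable
      ((condProb_ae_mem_Icc _).mono fun ω h => h.1) (condProb_le_sum_revealers G X a)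
  calc _ = ∫ ω, ∑ a,
        (μ⟦X ⁻¹' {a} | m⟧) ω / (∑ k ∈ revealers G a, μ⟦X ⁻¹' {k} | m⟧) ω ∂μ :=
        (integral_finsetSum _ fun a _ => hint a).symm
    _ ≤ ∫ _, (mas G : ℝ) ∂μ := by
        refine integral_mono_ae (integrable_finsetSum _ fun a _ => hint a) (integrable_const _) ?_
        filter_upwards [ae_forall_condProb_preimage_mem_Icc X] with ω hω
        simpa only [Finset.sum_apply] using sum_div_sum_revealers_le_mas G fun a => (hω a).1
    _ = mas G := by simp

lemma condEntropy_nonneg (X : Ω → V) : 0 ≤ condEntropy μ X m := by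
  refine integral_nonneg_of_ae ?_
  filter_upwards [ae_forall_condProb_preimage_mem_Icc X] with ω h
  rw [Pi.zero_apply, shannonEntropy_eq_sum_negMulLog]
  exact Finset.sum_nonneg fun a _ => Real.negMulLog_nonneg (h a).1 (h a).2

lemma apply_eq_sum_indicator_mul (X : Ω → V) (Y : V → Ω → ℝ) (ω : Ω) :
    Y (X ω) ω = ∑ a, (X ⁻¹' {a}).indicator (fun _ => 1) ω * Y a ω := by
  classical
  simp [Set.indicator_apply, eq_comm]

variable [MeasurableSpace V] [MeasurableSingletonClass V] {X A : Ω → V}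

omit [Fintype V] in
lemma integrable_indicator_mul (hX : Measurable X) {f : Ω → ℝ} (hf : Integrable f μ) (a : V) :
    Integrable (fun ω => (X ⁻¹' {a}).indicator (fun _ => 1) ω * f ω) μ := by
  classical
  simpa [Set.indicator_apply] using! hf.indicator (hX (measurableSet_singleton a))

omit [Fintype V] in
lemma integrable_apply [Finite V] (hX : Measurable X) {Y : V → Ω → ℝ}
    (hY : ∀ a, Integrable (Y a) μ) : Integrable (fun ω => Y (X ω) ω) μ := by
  have := Fintype.ofFinite V
  simp only [apply_eq_sum_indicator_mul X Y]
  exact integrable_finsetSum _ fun a _ => integrable_indicator_mul hX (hY a) a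

lemma integral_apply_eq_sum (hX : Measurable X) {Y : V → Ω → ℝ} (hY : ∀ a, Integrable (Y a) μ) :
    ∫ ω, Y (X ω) ω ∂μ = ∑ a, ∫ ω, (X ⁻¹' {a}).indicator (fun _ => 1) ω * Y a ω ∂μ := by
  simp only [apply_eq_sum_indicator_mul X Y]
  exact integral_finsetSum _ fun a _ => integrable_indicator_mul hX (hY a) a

variable [IsProbabilityMeasure μ]

lemma condEntropy_eq_sum_integral (hX : Measurable X) :
    condEntropy μ X m = ∑ a, ∫ ω, Real.negMulLog ((μ⟦X ⁻¹' {a} | m⟧) ω) ∂μ := by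
  simp only [condEntropy, shannonEntropy_eq_sum_negMulLog]
  exact integral_finsetSum _ fun a _ => (memLp_top_negMulLog
    (memLp_top_condProb (hX (measurableSet_singleton a))).1
    (condProb_ae_mem_Icc _)).integrable le_top

lemma condEntropy_bot (hX : Measurable X) :
    condEntropy μ X ⊥ = shannonEntropy fun a => μ.real (X ⁻¹' {a}) := by
  simp [condEntropy, condExp_bot, integral_indicator_const _ (hX (measurableSet_singleton _))]

omit [Fintype V] in
lemma condProb_preimage_finset (hA : Measurable A) (S : Finset V) :
    μ⟦A ⁻¹' S | m⟧ =ᵐ[μ] ∑ a ∈ S, μ⟦A ⁻¹' {a} | m⟧ := by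
  have hsum : (A ⁻¹' S).indicator (fun _ => (1 : ℝ)) =
      ∑ a ∈ S, (A ⁻¹' {a}).indicator fun _ => 1 := by
    classical
    ext ω
    simp [Set.indicator_apply, eq_comm]
  rw [hsum]
  exact condExp_finsetSum (fun a _ => (integrable_const 1).indicator
    (hA (measurableSet_singleton a))) m

/-- One round of Thompson sampling with graph feedback. The player knows `m` before and `m'` after
the round, whereas `n` also contains the target action `X` and all the rewards `Y`. Playing `A`
reveals the rewards of the closed out-neighbourhood of `A` in `G`, and `A` is drawn from the
conditional law of `X` given `m`, conditionally independently of `n`. -/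
structure ThompsonRound (μ : Measure Ω) (m m' n : MeasurableSpace Ω) (G : Digraph V) (X A : Ω → V)
    (Y : V → Ω → ℝ) : Prop where
  le_after : m ≤ m'
  le_full : m ≤ n
  after_le : m' ≤ mΩ
  full_le : n ≤ mΩ
  measurable_target : Measurable[n] X
  measurable_action : Measurable[m'] A
  measurable_reward : ∀ a, Measurable[n] (Y a)
  reward_mem_Icc : ∀ a ω, Y a ω ∈ Set.Icc 0 1
  measurable_feedback : ∀ a, Measurable[m'] ((A ⁻¹' revealers G a).indicator (Y a))
  sampling : ∀ a, μ⟦A ⁻¹' {a} | n⟧ =ᵐ[μ] μ⟦X ⁻¹' {a} | m⟧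

namespace ThompsonRound

variable {G : Digraph V} {Y : V → Ω → ℝ}

omit [MeasurableSingletonClass V] in
lemma memLp_reward (h : ThompsonRound μ m m' n G X A Y) (a : V) : MemLp (Y a) ⊤ μ :=
  memLp_of_bounded (.of_forall (h.reward_mem_Icc a))
    ((h.measurable_reward a).mono h.full_le le_rfl).aestronglyMeasurable ⊤

lemma condProb_revealers (h : ThompsonRound μ m m' n G X A Y) (a : V) :
    μ⟦A ⁻¹' revealers G a | n⟧ =ᵐ[μ] ∑ k ∈ revealers G a, μ⟦X ⁻¹' {k} | m⟧ :=
  (condProb_preimage_finset (h.measurable_action.mono h.after_le le_rfl) _).trans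
    (eventuallyEq_sum fun k _ => h.sampling k)

lemma integral_indicator_action_mul_reward (h : ThompsonRound μ m m' n G X A Y) (a : V) :
    ∫ ω, (A ⁻¹' {a}).indicator (fun _ => 1) ω * Y a ω ∂μ =
      ∫ ω, (X ⁻¹' {a}).indicator (fun _ => 1) ω * (μ[Y a | m]) ω ∂μ := by
  have hm := h.le_full.trans h.full_le
  have hA : MeasurableSet (A ⁻¹' {a}) :=
    h.after_le _ (h.measurable_action (measurableSet_singleton a))
  have hX : MeasurableSet (X ⁻¹' {a}) :=
    h.full_le _ (h.measurable_target (measurableSet_singleton a))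
  have hY := h.memLp_reward a
  calc ∫ ω, (A ⁻¹' {a}).indicator (fun _ => 1) ω * Y a ω ∂μ
      = ∫ ω, (μ⟦A ⁻¹' {a} | n⟧) ω * Y a ω ∂μ :=
        (integral_condExp_mul h.full_le ((memLp_const 1).indicator hA) hY
          (h.measurable_reward a).stronglyMeasurable).symm
    _ = ∫ ω, Y a ω * (μ⟦X ⁻¹' {a} | m⟧) ω ∂μ := by
        refine integral_congr_ae ?_
        filter_upwards [h.sampling a] with ω hω
        rw [hω, mul_comm]
    _ = ∫ ω, (μ⟦X ⁻¹' {a} | m⟧) ω * (μ[Y a | m]) ω ∂μ := by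
        rw [← integral_condExp_mul hm hY (memLp_top_condProb hX) stronglyMeasurable_condExp]
        simp only [mul_comm]
    _ = _ := integral_condExp_mul hm ((memLp_const 1).indicator hX) (memLp_top_condExp hY)
        stronglyMeasurable_condExp

lemma integrable_regret (h : ThompsonRound μ m m' n G X A Y) :
    Integrable (fun ω => Y (X ω) ω - Y (A ω) ω) μ :=
  have hY a : Integrable (Y a) μ := (h.memLp_reward a).integrable le_top
  (integrable_apply (h.measurable_target.mono h.full_le le_rfl) hY).sub
    (integrable_apply (h.measurable_action.mono h.after_le le_rfl) hY)

/-- The action has the same conditional law given `m` as the target, but it is conditionally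
independent of the rewards; so the regret is a sum of conditional covariances. -/
lemma integral_regret_eq_sum (h : ThompsonRound μ m m' n G X A Y) :
    ∫ ω, (Y (X ω) ω - Y (A ω) ω) ∂μ =
      ∑ a, ∫ ω, (X ⁻¹' {a}).indicator (fun _ => 1) ω * (Y a ω - (μ[Y a | m]) ω) ∂μ := by
  have hX : Measurable X := h.measurable_target.mono h.full_le le_rfl
  have hA : Measurable A := h.measurable_action.mono h.after_le le_rfl
  have hY a : Integrable (Y a) μ := (h.memLp_reward a).integrable le_top
  rw [integral_sub (integrable_apply hX hY) (integrable_apply hA hY), integral_apply_eq_sum hX hY,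
    integral_apply_eq_sum hA hY, ← Finset.sum_sub_distrib]
  refine Finset.sum_congr rfl fun a _ => ?_
  rw [h.integral_indicator_action_mul_reward, ← integral_sub (integrable_indicator_mul hX (hY a) a)
    (integrable_indicator_mul hX integrable_condExp a)]
  simp only [mul_sub]

lemma disclosure (h : ThompsonRound μ m m' n G X A Y) (a : V) :
    Disclosure μ m m' n (Y a) ((A ⁻¹' revealers G a).indicator fun _ => 1)
      (∑ k ∈ revealers G a, μ⟦X ⁻¹' {k} | m⟧) where
  le_after := h.le_after
  after_le := h.after_le
  le_full := h.le_full
  full_le := h.full_le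
  value_measurable := (h.measurable_reward a).stronglyMeasurable
  value_mem_Icc := .of_forall (h.reward_mem_Icc a)
  weight_measurable := stronglyMeasurable_const.indicator
    (h.measurable_action (revealers G a).measurableSet)
  weight_mem_Icc := .of_forall (indicator_one_mem_Icc _)
  observed_measurable := by
    have hfeedback : (A ⁻¹' revealers G a).indicator (fun _ => 1) * Y a =
        (A ⁻¹' revealers G a).indicator (Y a) := by
      classical
      ext ω
      simp only [Pi.mul_apply, Set.indicator_apply, ite_mul, one_mul, zero_mul]
    exact hfeedback ▸ (h.measurable_feedback a).stronglyMeasurable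
  prob_measurable := Finset.stronglyMeasurable_sum _ fun _ _ => stronglyMeasurable_condExp
  condExp_weight := h.condProb_revealers a

lemma mul_regret_le (h : ThompsonRound μ m m' n G X A Y) {c : ℝ} (hc : 0 < c) :
    c * ∫ ω, (Y (X ω) ω - Y (A ω) ω) ∂μ ≤
      condEntropy μ X m - condEntropy μ X m' + c ^ 2 / 8 * mas G := by
  have hX : Measurable X := h.measurable_target.mono h.full_le le_rfl
  have hXn a : StronglyMeasurable[n] ((X ⁻¹' {a}).indicator fun _ => (1 : ℝ)) :=
    stronglyMeasurable_const.indicator (h.measurable_target (measurableSet_singleton a))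
  rw [h.integral_regret_eq_sum, Finset.mul_sum, condEntropy_eq_sum_integral hX,
    condEntropy_eq_sum_integral hX, ← Finset.sum_sub_distrib]
  refine (Finset.sum_le_sum fun a _ => (h.disclosure a).mul_integral_mul_sub_condExp_le (hXn a)
    (.of_forall (indicator_one_mem_Icc _)) (condProb_le_sum_revealers G X a) hc).trans ?_
  rw [Finset.sum_add_distrib, ← Finset.mul_sum]
  gcongr
  exact sum_integral_condProb_div_le_mas G X

end ThompsonRound

end Rounds

namespace BayesianBandit

variable {K : ℕ} {Ω : Type*} [mΩ : MeasurableSpace Ω] {μ : Measure Ω}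
  (M : BayesianBandit K μ) {G : ℕ → Digraph (Fin K)} {A : ℕ → Ω → Fin K}

lemma measurable_observation (hA : ∀ t, Measurable (A t)) (t : ℕ) :
    Measurable (M.observation G A t) := by
  classical
  refine (hA t).prodMk (measurable_pi_lambda _ fun a => ?_)
  refine Measurable.ite ?_ ((measurable_pi_apply a).comp (M.measurable_Y t)) measurable_const
  exact hA t (.of_discrete (s := {k | a = k ∨ (G t).Adj k a}))

lemma history_le (hA : ∀ t, Measurable (A t)) (t : ℕ) : M.history G A t ≤ mΩ :=
  iSup₂_le fun s _ => (M.measurable_observation hA s).comap_le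

lemma history_le_succ (t : ℕ) : M.history G A t ≤ M.history G A (t + 1) :=
  biSup_mono fun _ hs => Finset.range_subset_range.2 t.le_succ hs

lemma measurable_observation_history (t : ℕ) :
    Measurable[M.history G A (t + 1)] (M.observation G A t) :=
  (comap_measurable _).mono
    (le_biSup (fun s => MeasurableSpace.comap (M.observation G A s) inferInstance)
      (Finset.self_mem_range_succ t)) le_rfl

lemma environment_le : M.environment ≤ mΩ :=
  sup_le (sup_le M.measurable_pStar.comap_le M.measurable_AStar.comap_le)
    (iSup_le fun t => (M.measurable_Y t).comap_le)

lemma measurable_AStar_environment : Measurable[M.environment] M.AStar :=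
  (comap_measurable _).mono (le_sup_right.trans le_sup_left) le_rfl

lemma measurable_Y_environment (t : ℕ) : Measurable[M.environment] (M.Y t) :=
  (comap_measurable _).mono
    ((le_iSup (fun t => MeasurableSpace.comap (M.Y t) inferInstance) t).trans le_sup_right) le_rfl

lemma indicator_revealers_eq_observation (t : ℕ) (a : Fin K) :
    (A t ⁻¹' revealers (G t) a).indicator (fun ω => (M.Y t ω a : ℝ)) =
      fun ω => ((M.observation G A t ω).2 a : ℝ) := by
  classical
  ext ω
  simp only [observation, Set.indicator_apply, Set.mem_preimage, Finset.mem_coe, mem_revealers]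
  split_ifs <;> rfl

lemma condEntropy_history_zero [IsProbabilityMeasure μ] :
    condEntropy μ M.AStar (M.history G A 0) = shannonEntropy M.prior := by
  have hbot : M.history G A 0 = ⊥ := by simp [history]
  rw [hbot, condEntropy_bot M.measurable_AStar]
  rfl

variable {M}

lemma IsTSN.thompsonRound (hA : M.IsTSN G A) (t : ℕ) :
    ThompsonRound μ (M.history G A t) (M.history G A (t + 1)) (M.history G A t ⊔ M.environment)
      (G t) M.AStar (A t) (fun a ω => M.Y t ω a) where
  le_after := M.history_le_succ t
  le_full := le_sup_left
  after_le := M.history_le hA.measurable_action (t + 1)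
  full_le := sup_le (M.history_le hA.measurable_action t) M.environment_le
  measurable_target := M.measurable_AStar_environment.mono le_sup_right le_rfl
  measurable_action := measurable_fst.comp (M.measurable_observation_history t)
  measurable_reward a := measurable_subtype_coe.comp <|
    (measurable_pi_apply a).comp ((M.measurable_Y_environment t).mono le_sup_right le_rfl)
  reward_mem_Icc a ω := (M.Y t ω a).2
  measurable_feedback a := by
    rw [M.indicator_revealers_eq_observation]
    exact measurable_subtype_coe.comp <| (measurable_pi_apply a).comp <|
      measurable_snd.comp (M.measurable_observation_history t)
  sampling := hA.sampling t

end BayesianBandit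

end GraphBandit

open GraphBandit in
theorem mainTheorem6_general {Ω V : Type*} [MeasurableSpace Ω] [Fintype V] [MeasurableSpace V]
    [MeasurableSingletonClass V] (μ : Measure Ω) [IsProbabilityMeasure μ] (G : ℕ → Digraph V)
    (X : Ω → V) (A : ℕ → Ω → V) (Y : ℕ → V → Ω → ℝ) (ℱ 𝓔 : ℕ → MeasurableSpace Ω)
    (h : ∀ t, ThompsonRound μ (ℱ t) (ℱ (t + 1)) (𝓔 t) (G t) X (A t) (Y t)) (T : ℕ) :
    ∫ ω, ∑ t ∈ Finset.range T, (Y t (X ω) ω - Y t (A t ω) ω) ∂μ ≤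
      √((1 / 2 : ℝ) * ∑ t ∈ Finset.range T, (mas (G t) : ℝ) * condEntropy μ X (ℱ 0)) := by
  rw [integral_finsetSum _ fun t _ => (h t).integrable_regret, ← Finset.sum_mul]
  refine le_sqrt_of_forall_mul_le (condEntropy_nonneg X)
    (Finset.sum_nonneg fun t _ => Nat.cast_nonneg _) fun c hc => ?_
  calc c * ∑ t ∈ Finset.range T, ∫ ω, (Y t (X ω) ω - Y t (A t ω) ω) ∂μ
      ≤ ∑ t ∈ Finset.range T,
          (condEntropy μ X (ℱ t) - condEntropy μ X (ℱ (t + 1)) + c ^ 2 / 8 * mas (G t)) := by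
        rw [Finset.mul_sum]
        exact Finset.sum_le_sum fun t _ => (h t).mul_regret_le hc
    _ = condEntropy μ X (ℱ 0) - condEntropy μ X (ℱ T) +
          c ^ 2 / 8 * ∑ t ∈ Finset.range T, (mas (G t) : ℝ) := by
        rw [Finset.sum_add_distrib, Finset.sum_range_sub', Finset.mul_sum]
    _ ≤ _ := by linarith [condEntropy_nonneg (μ := μ) (m := ℱ T) X]

theorem mainTheorem6 {K : ℕ} {Ω : Type*} [MeasurableSpace Ω] (μ : Measure Ω)
    [IsProbabilityMeasure μ] (M : GraphBandit.BayesianBandit K μ)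
    (G : ℕ → Digraph (Fin K)) (A : ℕ → Ω → Fin K) (hA : M.IsTSN G A) (T : ℕ) :
    M.bayesRegret A T ≤
      √((1 / 2 : ℝ) * ∑ t ∈ Finset.range T,
        (GraphBandit.mas (G t) : ℝ) * GraphBandit.shannonEntropy M.prior) := by
  rw [← M.condEntropy_history_zero (G := G) (A := A)]
  exact mainTheorem6_general μ G M.AStar A (fun t a ω => M.Y t ω a) _ _ hA.thompsonRound T
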